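/- Let $n\ge 1$ and let $\omega_0\in S_{n+1}$ be the longest element, the order-reversing permutation. Let $\overline{\omega_0}=s_{i_1}s_{i_2}\cdots s_{i_N}$ be a reduced decomposition of $\omega_0$ (a product of simple transpositions of minimal length), so $N=n(n+1)/2$. String diagram: start with $n+1$ strings $U_1,\dots,U_{n+1}$, numbered from left to right at the top, and go down; for $j=1,\dots,N$, the strings in positions $i_j$ and $i_j+1$ cross at a vertex $t_j$, which lies in column $i_j$. Let $b_a$ be the lower end of $U_a$. Rigorous paths: for $1\le k\le n$ orient $U_1,\dots,U_k$ upward and the other strings downward. A rigorous path is an oriented path from $b_k$ to $b_{k+1}$ for some $k$ which meets no vertex more than once and never goes straight through a vertex along (i) the string running to the upper left when both strings crossing there are oriented upward, or (ii) the string coming from the upper right when both strings crossing there are oriented downward. Its string inequality is $\sum_j a_jx_j\ge 0$, where $a_j=1$ (resp. $a_j=-1$) if at $t_j$ the path switches from $U_p$ to $U_q$ with $p<q$ (resp. $p>q$), and $a_j=0$ otherwise. Let $\Delta(\overline{\omega_0})\subset\mathbb R^N$ be the set of all $x$ which satisfy all string inequalities and the $\lambda$-inequalities $$x_l\le 2+\sum_{j>l}c_{lj}x_j\qquad(1\le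 l\le N),$$ where $c_{lj}=1$ if $|i_j-i_l|=1$, $c_{lj}=-2$ if $i_j=i_l$, and $c_{lj}=0$ otherwise. Theorem. For every reduced decomposition $\overline{\omega_0}$ of $\omega_0$, the set $\Delta=\Delta(\overline{\omega_0})$ is bounded, it has exactly one point $P$ of $\mathbb Z^N$ in its interior, and its dual polytope $$\Delta^*(\overline{\omega_0})=\{\,y\in\mathbb R^N : \langle y,x-P\rangle\le 1\ \text{ for all } x\in\Delta\,\}$$ is integral, that is, it is the convex hull of a finite set of points of $\mathbb Z^N$. -/

import Mathlib

/-! ### Reduced decompositions in the symmetric group `S_{n+1}`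

The simple reflections are indexed by `Fin n`; the `c`-th one is the transposition of `c` and
`c + 1` in `Fin (n + 1)`.  Everything is numbered from `0`. -/

namespace StringPolytope

/-- The simple reflection `s_c`, exchanging `c` and `c + 1`. -/
def simpleReflection {n : ℕ} (c : Fin n) : Equiv.Perm (Fin (n + 1)) :=
  Equiv.swap c.castSucc c.succ

/-- The permutation `s_{w 0} s_{w 1} ⋯ s_{w (N - 1)}` represented by a word `w`. -/
def wordProd {n N : ℕ} (w : Fin N → Fin n) : Equiv.Perm (Fin (n + 1)) :=
  (List.ofFn fun j => simpleReflection (w j)).prod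

/-- `w` is a reduced decomposition of `σ`: it represents `σ`, and no shorter word does. -/
def IsReducedDecomposition {n N : ℕ} (w : Fin N → Fin n) (σ : Equiv.Perm (Fin (n + 1))) : Prop :=
  wordProd w = σ ∧ ∀ (M : ℕ) (v : Fin M → Fin n), wordProd v = σ → N ≤ M

/-- The longest element `w₀` of `S_{n+1}`: the permutation reversing the order. -/
def longestElement (n : ℕ) : Equiv.Perm (Fin (n + 1)) :=
  Fin.revPerm

/-! ### The string diagram of a word

There are `n + 1` strings, numbered from left to right at the top.  Going down, the `j`-th crossing
`t_j` exchanges the strings in the positions `w j` and `w j + 1`; `t_j` lies in column `w j`. -/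

/-- `stringAt w l p` is the string in position `p` just below the first `l` crossings. -/
def stringAt {n N : ℕ} (w : Fin N → Fin n) (l : Fin (N + 1)) : Equiv.Perm (Fin (n + 1)) :=
  Fin.partialProd (fun j => simpleReflection (w j)) l

/-- The string which passes through `t_j` from the upper left to the lower right. -/
def upperLeft {n N : ℕ} (w : Fin N → Fin n) (j : Fin N) : Fin (n + 1) :=
  stringAt w j.castSucc (w j).castSucc

/-- The string which passes through `t_j` from the upper right to the lower left. -/
def upperRight {n N : ℕ} (w : Fin N → Fin n) (j : Fin N) : Fin (n + 1) :=
  stringAt w j.castSucc (w j).succ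

/-- The string `U_a` passes through the vertex `t_j`. -/
def OnString {n N : ℕ} (w : Fin N → Fin n) (j : Fin N) (a : Fin (n + 1)) : Prop :=
  a = upperLeft w j ∨ a = upperRight w j

/-- `t_j` is the lowest vertex on `U_a`, i.e. the neighbour of the lower end `b_a` of `U_a`. -/
def IsLowestOn {n N : ℕ} (w : Fin N → Fin n) (j : Fin N) (a : Fin (n + 1)) : Prop :=
  OnString w j a ∧ ∀ m, OnString w m a → m ≤ j

/-- `t_j` and `t_m` lie on `U_a`, with `t_j` above `t_m` and no vertex of `U_a` in between. -/
def IsJustAboveOn {n N : ℕ} (w : Fin N → Fin n) (a : Fin (n + 1)) (j m : Fin N) : Prop :=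
  OnString w j a ∧ OnString w m a ∧ j < m ∧ ∀ q, OnString w q a → ¬(j < q ∧ q < m)

/-! ### Rigorous paths

For `k : Fin n`, the strings `U_0, …, U_k` are oriented upward and `U_{k+1}, …, U_n` downward. -/

/-- In the orientation belonging to `k`, the string `U_a` is oriented upward. -/
def IsUpward {n : ℕ} (k : Fin n) (a : Fin (n + 1)) : Prop :=
  a ≤ k.castSucc

/-- The oriented edge of the graph along `U_a` that starts in `t_j` ends in `t_m`. -/
def IsOrientedEdge {n N : ℕ} (w : Fin N → Fin n) (k : Fin n) (a : Fin (n + 1)) (j m : Fin N) :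
    Prop :=
  (IsUpward k a ∧ IsJustAboveOn w a m j) ∨ (¬IsUpward k a ∧ IsJustAboveOn w a j m)

/-- The passage of a path through a vertex: the path arrives in the vertex `t_vertex` along the
string `U_arrive` and leaves it along `U_leave`. -/
@[ext]
structure Passage (n N : ℕ) where
  vertex : Fin N
  arrive : Fin (n + 1)
  leave : Fin (n + 1)

/-- The bad fragments: the path goes straight along one of two strings which cross in a vertex,
namely along the one going to the upper left if both strings are oriented upward, or along the one
coming from the upper right if both strings are oriented downward. -/
def IsBad {n N : ℕ} (w : Fin N → Fin n) (k : Fin n) (s : Passage n N) : Prop :=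
  (IsUpward k (upperLeft w s.vertex) ∧ IsUpward k (upperRight w s.vertex) ∧
    s.arrive = upperLeft w s.vertex ∧ s.leave = upperLeft w s.vertex) ∨
  (¬IsUpward k (upperLeft w s.vertex) ∧ ¬IsUpward k (upperRight w s.vertex) ∧
    s.arrive = upperRight w s.vertex ∧ s.leave = upperRight w s.vertex)

/-- The list `p` of the successive passages describes a rigorous path for `k`: an oriented path from
the lower end of `U_k` to the lower end of `U_{k+1}` which meets no vertex more than once and avoids
the bad fragments. -/
structure IsRigorousPath {n N : ℕ} (w : Fin N → Fin n) (k : Fin n) (p : List (Passage n N)) :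
    Prop where
  ne_nil : p ≠ []
  on_strings : ∀ s ∈ p, OnString w s.vertex s.arrive ∧ OnString w s.vertex s.leave
  start : ∀ s ∈ p.head?, s.arrive = k.castSucc ∧ IsLowestOn w s.vertex k.castSucc
  finish : ∀ s ∈ p.getLast?, s.leave = k.succ ∧ IsLowestOn w s.vertex k.succ
  edges : p.IsChain fun s s' => s'.arrive = s.leave ∧ IsOrientedEdge w k s.leave s.vertex s'.vertex
  nodup : (p.map Passage.vertex).Nodup
  not_bad : ∀ s ∈ p, ¬IsBad w k s

/-- The contribution of a passage to the coefficient at its vertex: `1` if the path switches from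
`U_a` to `U_b` with `a < b`, `-1` if it switches from `U_a` to `U_b` with `a > b`, `0` if it goes
straight. -/
def switchSign {n N : ℕ} (s : Passage n N) : ℤ :=
  if s.arrive < s.leave then 1 else if s.leave < s.arrive then -1 else 0

/-- The coefficient at `x_j` in the string inequality of the path `p`. -/
def pathCoeff {n N : ℕ} (p : List (Passage n N)) (j : Fin N) : ℤ :=
  (p.map fun s => if s.vertex = j then switchSign s else 0).sum

/-! ### The polytope `Δ` -/

/-- The string cone: all string inequalities `∑ a_j x_j ≥ 0` hold. -/
def stringCone {n N : ℕ} (w : Fin N → Fin n) : Set (Fin N → ℝ) :=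
  {x | ∀ (k : Fin n) (p : List (Passage n N)), IsRigorousPath w k p →
    0 ≤ ∑ j, (pathCoeff p j : ℝ) * x j}

/-- The coefficient `c_j` in the `λ`-inequality of `t_i`: `1` if `t_j` is one column to the right or
left of `t_i`, `-2` if it is in the same column, and `0` otherwise. -/
def lambdaCoeff {n N : ℕ} (w : Fin N → Fin n) (i j : Fin N) : ℤ :=
  if (w j : ℕ) = w i + 1 ∨ (w i : ℕ) = w j + 1 then 1 else if w j = w i then -2 else 0

/-- The `λ`-cone: `x_i ≤ 2 + ∑_{j > i} c_j x_j` for all `i`. -/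
def lambdaCone {n N : ℕ} (w : Fin N → Fin n) : Set (Fin N → ℝ) :=
  {x | ∀ i, x i ≤ 2 + ∑ j ∈ Finset.Ioi i, (lambdaCoeff w i j : ℝ) * x j}

/-- The string-degeneration polytope `Δ(w)`, the intersection of the two cones. -/
def stringPolytope {n N : ℕ} (w : Fin N → Fin n) : Set (Fin N → ℝ) :=
  stringCone w ∩ lambdaCone w

/-! ### Dual polytopes and integrality -/

/-- The point of `ℝ^N` given by a point of the lattice `ℤ^N`. -/
def latticePoint {N : ℕ} (P : Fin N → ℤ) : Fin N → ℝ :=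
  fun j => (P j : ℝ)

/-- The dual (polar) of `S` with respect to the point `P`, i.e. with `P` taken as the origin:
the set of all `y` with `⟨y, x - P⟩ ≤ 1` for all `x ∈ S`. -/
def dualPolytope {N : ℕ} (S : Set (Fin N → ℝ)) (P : Fin N → ℝ) : Set (Fin N → ℝ) :=
  {y | ∀ x ∈ S, ∑ j, y j * (x j - P j) ≤ 1}

/-- An integral polytope: the convex hull of a finite set of points of the lattice `ℤ^N`. -/
def IsIntegralPolytope {N : ℕ} (S : Set (Fin N → ℝ)) : Prop :=
  ∃ V : Finset (Fin N → ℤ), S = convexHull ℝ (latticePoint '' (V : Set (Fin N → ℤ)))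

end StringPolytope

/-!
Let `P_j = b - a` when the strings `U_a` and `U_b`, `a < b`, cross in the vertex `t_j`. All the
inequalities which define `Δ(w)` have the value `1` at `P`:

* a rigorous path leads from `U_k` to `U_{k+1}`, and a passage from `U_p` to `U_q` contributes
  `q - p`, so that the sum telescopes (`sum_pathCoeff_mul_crossingHeight`);
* for the `λ`-inequality of `t_l` the difference of the strings in the positions `i_l` and `i_l + 1`
  telescopes over the levels below `t_l` (`sum_lambdaCoeff_mul_crossingHeight`).

Thus `Δ(w) = {x | ⟨y, x - P⟩ ≤ 1 for y ∈ A}` for a finite set `A` of integral vectors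
(`stringPolytope_eq_unitPolyhedron`). For every polyhedron of this kind the dual is the convex hull
of `A ∪ {0}`, by separation (`isIntegralPolytope_dualPolytope`). If it is bounded, `P` is its only
interior lattice point: at an interior lattice point `Q` the integers `⟨y, Q - P⟩` are less than
`1`, so the ray from `P` through `Q` does not leave the polyhedron
(`latticePoint_mem_interior_iff`).

For boundedness it suffices that `x ≥ 0` on the string cone, as the `λ`-inequalities then bound
`x_N`, `x_{N-1}`, … from above in turn. Going upward through the vertices, it is enough to find for
each crossing `t_j` of `U_a` and `U_b` a rigorous path with coefficient `1` at `t_j`, whose other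
coefficients are nonpositive and belong to vertices below `t_j`. Choose `k` with `a ≤ k < b` such
that below `t_j` the string `U_k` is on the right of the crossing and `U_{k+1}` on the left; it
exists since `U_a` is on the right and `U_b` on the left. From `t_j` follow `U_b` downward and
switch to every crossing string with a smaller number above `k`; and backward from `t_j` follow
`U_a` downward and switch to every crossing string with a larger number up to `k`. Two strings
cross at most once in a reduced word (`IsReducedDecomposition.upperLeft_lt_upperRight`), the first
walk stays to the left of the second, it never gets to the left of `U_{k+1}`, and the second never
to the right of `U_k` (`strand_invariant`). At the bottom the order of the strings is reversed,
which forces the ends `b_{k+1}` and `b_k` (`strand_last`).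
-/

namespace StringPolytope

/-! ### Polyhedra with integral normals at lattice distance one -/

/-- The polyhedron `{x | ⟨y, x - P⟩ ≤ 1 for y ∈ A}`. -/
def unitPolyhedron {N : ℕ} (A : Set (Fin N → ℤ)) (P : Fin N → ℤ) : Set (Fin N → ℝ) :=
  {x | ∀ y ∈ A, ∑ j, (y j : ℝ) * (x j - P j) ≤ 1}

/-- At an interior lattice point `Q` each of the integers `⟨y, Q - P⟩` is less than `1`, hence at
most `0`, so that the ray from `P` through `Q` stays in the polyhedron. -/
lemma latticePoint_mem_interior_iff {N : ℕ} {A : Set (Fin N → ℤ)} (hA : A.Finite)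
    {P : Fin N → ℤ} (hb : Bornology.IsBounded (unitPolyhedron A P)) (Q : Fin N → ℤ) :
    latticePoint Q ∈ interior (unitPolyhedron A P) ↔ Q = P := by
  constructor
  · intro hQ
    -- the point `Q + (ε / 2) (Q - P)` still lies in the polyhedron
    have hval : ∀ y ∈ A, ∑ j, y j * (Q j - P j) ≤ 0 := by
      intro y hy
      have hcont : Filter.Tendsto
          (fun t : ℝ => fun j => (Q j : ℝ) + t * ((Q j : ℝ) - P j)) (nhds 0)
          (nhds (latticePoint Q)) := by
        have : Continuous (fun t : ℝ => fun j => (Q j : ℝ) + t * ((Q j : ℝ) - P j)) := by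
          fun_prop
        have h := this.tendsto 0
        change Filter.Tendsto _ _ (nhds fun j => (Q j : ℝ))
        simpa using h
      have hev := hcont.eventually (mem_interior_iff_mem_nhds.1 hQ)
      obtain ⟨ε, hε, hmem⟩ := Metric.eventually_nhds_iff.1 hev
      have h1 := hmem (y := ε / 2) (by simp [abs_of_pos hε]; linarith) y hy
      have h2 : ∑ j, (y j : ℝ) * ((Q j : ℝ) + ε / 2 * ((Q j : ℝ) - P j) - P j)
          = (1 + ε / 2) * ((∑ j, y j * (Q j - P j) : ℤ) : ℝ) := by
        push_cast
        rw [Finset.mul_sum]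
        exact Finset.sum_congr rfl fun j _ => by ring
      rw [h2] at h1
      by_contra! hpos
      have h3 : (1 : ℝ) ≤ ((∑ j, y j * (Q j - P j) : ℤ) : ℝ) := by exact_mod_cast hpos
      nlinarith
    have hray : ∀ t : ℝ, 0 ≤ t →
        (fun j => (P j : ℝ) + t * ((Q j : ℝ) - P j)) ∈ unitPolyhedron A P := by
      intro t ht y hy
      have h2 : ∑ j, (y j : ℝ) * ((P j : ℝ) + t * ((Q j : ℝ) - P j) - P j)
          = t * ((∑ j, y j * (Q j - P j) : ℤ) : ℝ) := by
        push_cast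
        rw [Finset.mul_sum]
        exact Finset.sum_congr rfl fun j _ => by ring
      rw [h2]
      have h3 : ((∑ j, y j * (Q j - P j) : ℤ) : ℝ) ≤ 0 := by exact_mod_cast hval y hy
      nlinarith
    -- if `Q j ≠ P j`, the ray leaves the ball of radius `C` in the `j`-th coordinate
    obtain ⟨C, hC⟩ := hb.exists_norm_le
    funext j
    by_contra hne
    have hd : 0 < |(Q j : ℝ) - P j| := by
      rw [abs_pos, sub_ne_zero]
      exact_mod_cast hne
    set d : ℝ := |(Q j : ℝ) - P j| with hddef
    have hC0 : 0 ≤ C := (norm_nonneg _).trans (hC _ (hray 0 le_rfl))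
    have ht : 0 ≤ (C + |(P j : ℝ)| + 1) / d := by positivity
    have h4 := (norm_le_pi_norm _ j).trans (hC _ (hray _ ht))
    have h5 := abs_sub_abs_le_abs_sub
      ((C + |(P j : ℝ)| + 1) / d * ((Q j : ℝ) - P j)) (-(P j : ℝ))
    rw [abs_mul, abs_of_nonneg ht, ← hddef, div_mul_cancel₀ _ hd.ne', abs_neg, sub_neg_eq_add,
      add_comm (_ * _)] at h5
    rw [Real.norm_eq_abs] at h4
    linarith
  · rintro rfl
    have hopen : IsOpen {x : Fin N → ℝ | ∀ y ∈ A, ∑ j, (y j : ℝ) * (x j - Q j) < 1} := by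
      have : {x : Fin N → ℝ | ∀ y ∈ A, ∑ j, (y j : ℝ) * (x j - Q j) < 1}
          = ⋂ y ∈ A, {x : Fin N → ℝ | ∑ j, (y j : ℝ) * (x j - Q j) < 1} := by
        ext; simp
      rw [this]
      exact hA.isOpen_biInter fun y _ => isOpen_lt (by fun_prop) continuous_const
    refine mem_interior.2 ⟨_, fun x hx y hy => (hx y hy).le, hopen, fun y _ => ?_⟩
    simp [latticePoint]

/-- The bipolar theorem for a finite set `A` of normals: the dual of the polyhedron is the convex
hull of `A` and the origin. -/
lemma isIntegralPolytope_dualPolytope {N : ℕ} {A : Set (Fin N → ℤ)} (hA : A.Finite)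
    (P : Fin N → ℤ) :
    IsIntegralPolytope (dualPolytope (unitPolyhedron A P) (latticePoint P)) := by
  classical
  refine ⟨insert 0 hA.toFinset, Set.Subset.antisymm ?_ ?_⟩
  · intro y hy
    by_contra hnot
    have hfin : (latticePoint '' ((insert 0 hA.toFinset : Finset (Fin N → ℤ)) :
        Set (Fin N → ℤ))).Finite := (Finset.finite_toSet _).image _
    obtain ⟨f, u, hfu, huy⟩ := geometric_hahn_banach_closed_point
      (convex_convexHull ℝ _) (hfin.isClosed_convexHull ℝ) hnot
    have hf : ∀ z : Fin N → ℝ, f z = ∑ j, z j * f (Pi.single j 1) := fun z => by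
      conv_lhs => rw [pi_eq_sum_univ' z]
      simp [map_sum, map_smul]
    -- `u` is positive since the origin lies in the convex hull
    have hu : 0 < u := by
      have := hfu (latticePoint 0) (subset_convexHull ℝ _ ⟨0, by simp, rfl⟩)
      have h0 : latticePoint (0 : Fin N → ℤ) = 0 := by funext j; simp [latticePoint]
      rwa [h0, map_zero] at this
    have hsum : ∀ z : Fin N → ℝ,
        ∑ j, z j * ((P j + f (Pi.single j 1) / u) - P j) = f z / u := fun z => by
      rw [hf, Finset.sum_div]
      exact Finset.sum_congr rfl fun j _ => by ring
    -- `f / u`, moved to `P`, is a point of the polyhedron at which `y` takes a value above `1`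
    have hx : (fun j => (P j : ℝ) + f (Pi.single j 1) / u) ∈ unitPolyhedron A P := by
      intro z hz
      have := hfu (latticePoint z) (subset_convexHull ℝ _ ⟨z, by simp [hz], rfl⟩)
      have h2 := hsum (latticePoint z)
      simp only [latticePoint] at h2 this
      rw [h2, div_le_one hu]
      exact this.le
    have h1 := hy _ hx
    simp only [latticePoint] at h1
    rw [hsum, div_le_one hu] at h1
    linarith
  · refine convexHull_min ?_ ?_
    · rintro _ ⟨z, hz, rfl⟩ x hx
      simp only [Finset.coe_insert, Set.Finite.coe_toFinset, Set.mem_insert_iff] at hz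
      rcases hz with rfl | hz
      · simp [latticePoint]
      · exact hx z hz
    · intro y hy z hz a b ha hb hab x hx
      have h1 := hy x hx
      have h2 := hz x hx
      have : ∑ j, (a • y + b • z) j * (x j - latticePoint P j)
          = a * ∑ j, y j * (x j - latticePoint P j) + b * ∑ j, z j * (x j - latticePoint P j) := by
        rw [Finset.mul_sum, Finset.mul_sum, ← Finset.sum_add_distrib]
        exact Finset.sum_congr rfl fun j _ => by simp; ring
      rw [this]
      nlinarith

/-! ### Reduced words and the positions of the strings -/

/-- The strong exchange property: if `a < b` and `b` comes before `a` in the permutation given by a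
word, then deleting one letter of the word swaps `a` and `b`. -/
lemma exists_swap_mul_prod {n : ℕ} {a b : Fin (n + 1)} (hab : a < b) (L : List (Fin n))
    (h : (L.map simpleReflection).prod⁻¹ b < (L.map simpleReflection).prod⁻¹ a) :
    ∃ L' : List (Fin n), L'.length + 1 = L.length ∧
      (L'.map simpleReflection).prod = Equiv.swap a b * (L.map simpleReflection).prod := by
  induction L using List.reverseRecOn with
  | nil => exact absurd h (by simpa using hab.le)
  | append_singleton M c ih =>
    simp only [List.map_append, List.map_cons, List.map_nil, List.prod_append, List.prod_cons,
      List.prod_nil, mul_one] at h ih ⊢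
    set π := (M.map simpleReflection).prod with hπ
    by_cases hM : π⁻¹ b < π⁻¹ a
    · obtain ⟨M', hlen, hM'⟩ := ih hM
      exact ⟨M' ++ [c], by simp [← hlen], by simp [hM', mul_assoc]⟩
    · refine ⟨M, by simp, ?_⟩
      -- the last letter must exchange `a` and `b`
      have hne : π⁻¹ a ≠ π⁻¹ b := fun e => hab.ne (π⁻¹.injective e)
      have hlt : π⁻¹ a < π⁻¹ b := lt_of_le_of_ne (not_lt.1 hM) hne
      have hs : (simpleReflection c)⁻¹ = simpleReflection c := Equiv.swap_inv _ _
      rw [mul_inv_rev, hs, Equiv.Perm.mul_apply, Equiv.Perm.mul_apply] at h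
      have hac : π⁻¹ a = c.castSucc ∧ π⁻¹ b = c.succ := by
        simp only [simpleReflection, Equiv.swap_apply_def] at h
        simp only [Fin.ext_iff, Fin.lt_def] at *
        split_ifs at h <;> simp_all <;> omega
      have hsw : simpleReflection c = π⁻¹ * Equiv.swap a b * π := by
        have := Equiv.swap_apply_apply π⁻¹ a b
        rw [hac.1, hac.2, inv_inv] at this
        exact this
      rw [← hπ, hsw, ← mul_assoc, ← mul_assoc]
      simp [mul_assoc]

variable {n N : ℕ} {w : Fin N → Fin n}

lemma stringAt_succ (w : Fin N → Fin n) (j : Fin N) :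
    stringAt w j.succ = stringAt w j.castSucc * simpleReflection (w j) :=
  Fin.partialProd_succ _ _

lemma stringAt_last (w : Fin N → Fin n) : stringAt w (Fin.last N) = wordProd w := by
  rw [stringAt, Fin.partialProd, wordProd, List.take_of_length_le (by simp)]

/-- In a reduced word two strings which have crossed do not cross again: otherwise, by the strong
exchange property, both crossings could be removed. -/
lemma IsReducedDecomposition.upperLeft_lt_upperRight {σ : Equiv.Perm (Fin (n + 1))}
    (hw : IsReducedDecomposition w σ) (j : Fin N) : upperLeft w j < upperRight w j := by
  by_contra hlt
  have hne : upperRight w j ≠ upperLeft w j := fun e => by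
    have := (stringAt w j.castSucc).injective e
    simp [Fin.ext_iff] at this
  have hlt' : upperRight w j < upperLeft w j := lt_of_le_of_ne (not_lt.1 hlt) hne
  set L := List.ofFn w with hL
  have hlen : L.length = N := by simp [hL]
  have hjL : (j : ℕ) < L.length := by simp [hL]
  have hLj : L[(j : ℕ)] = w j := by simp [hL]
  have hmap : (List.ofFn fun i => simpleReflection (w i)) = L.map simpleReflection := by
    simp [hL, List.map_ofFn, Function.comp_def]
  have htake : stringAt w j.castSucc = ((L.take j).map simpleReflection).prod := by
    rw [stringAt, Fin.partialProd, hmap, List.map_take]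
    rfl
  obtain ⟨L', hl', hp'⟩ := exists_swap_mul_prod hlt' (L.take j) (by
    rw [← htake]
    simp [upperLeft, upperRight, Fin.lt_def])
  have hsw : Equiv.swap (upperRight w j) (upperLeft w j) * stringAt w j.castSucc
      = stringAt w j.castSucc * simpleReflection (w j) := by
    rw [upperLeft, upperRight, Equiv.swap_comm, Equiv.swap_apply_apply, simpleReflection]
    simp [mul_assoc]
  have hprod : ((L' ++ L.drop (j + 1)).map simpleReflection).prod = σ := by
    rw [List.map_append, List.prod_append, hp', ← htake, hsw, htake, ← hw.1, wordProd, hmap]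
    conv_rhs => rw [← List.take_append_drop j L, List.drop_eq_getElem_cons hjL, hLj]
    simp [mul_assoc]
  have hmin := hw.2 (L' ++ L.drop (j + 1)).length (fun i => (L' ++ L.drop (j + 1)).get i) (by
    rw [← hprod, wordProd]
    congr 1
    exact List.ext_getElem (by simp) fun i h1 h2 => by
      simp only [List.getElem_ofFn, List.getElem_map, List.get_eq_getElem])
  simp only [List.length_append, List.length_drop, List.length_take] at hmin hl'
  omega

/-- The position of the string `U_a` just below the first `l` crossings. -/
def position (w : Fin N → Fin n) (l : Fin (N + 1)) (a : Fin (n + 1)) : ℕ :=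
  ((stringAt w l).symm a : Fin (n + 1))

lemma position_injective (w : Fin N → Fin n) (l : Fin (N + 1)) :
    Function.Injective (position w l) :=
  Fin.val_injective.comp (stringAt w l).symm.injective

lemma position_upperLeft (w : Fin N → Fin n) (j : Fin N) :
    position w j.castSucc (upperLeft w j) = w j := by
  simp [position, upperLeft]

lemma position_upperRight (w : Fin N → Fin n) (j : Fin N) :
    position w j.castSucc (upperRight w j) = w j + 1 := by
  simp [position, upperRight]

lemma upperLeft_ne_upperRight (w : Fin N → Fin n) (j : Fin N) :
    upperLeft w j ≠ upperRight w j := fun e => by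
  have := position_upperLeft w j
  rw [e, position_upperRight] at this
  omega

lemma position_succ (w : Fin N → Fin n) (j : Fin N) (a : Fin (n + 1)) :
    position w j.succ a = if a = upperLeft w j then (w j : ℕ) + 1
      else if a = upperRight w j then (w j : ℕ) else position w j.castSucc a := by
  have hs : (simpleReflection (w j)).symm = simpleReflection (w j) := Equiv.symm_swap _ _
  have h : position w j.succ a =
      (simpleReflection (w j) ((stringAt w j.castSucc).symm a) : Fin (n + 1)) := by
    rw [position, stringAt_succ]
    conv_rhs => rw [← hs]
    rfl
  rw [h, simpleReflection, Equiv.swap_apply_def, upperLeft, upperRight]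
  simp only [Equiv.symm_apply_eq, position]
  split_ifs <;> simp

lemma position_last (hw : wordProd w = longestElement n) (a : Fin (n + 1)) :
    position w (Fin.last N) a = n - a := by
  rw [position, stringAt_last, hw, longestElement]
  simp [Fin.val_rev]

/-! ### The interior point: heights of the crossings -/

/-- The difference of the numbers of the two strings which cross in `t_j`, that is, the height of
the positive root belonging to this crossing. -/
def crossingHeight (w : Fin N → Fin n) (j : Fin N) : ℤ :=
  (upperRight w j : ℕ) - (upperLeft w j : ℕ)

lemma sum_pathCoeff_mul (p : List (Passage n N)) (x : Fin N → ℝ) :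
    ∑ j, (pathCoeff p j : ℝ) * x j = (p.map fun s => (switchSign s : ℝ) * x s.vertex).sum := by
  induction p with
  | nil => simp [pathCoeff]
  | cons s p ih =>
    have : ∀ j, pathCoeff (s :: p) j = (if s.vertex = j then switchSign s else 0) + pathCoeff p j :=
      fun j => by simp [pathCoeff]
    simp [this, add_mul, Finset.sum_add_distrib, ih]

lemma switchSign_mul_crossingHeight (hlt : ∀ j, upperLeft w j < upperRight w j)
    {s : Passage n N} (ha : OnString w s.vertex s.arrive) (hl : OnString w s.vertex s.leave) :
    switchSign s * crossingHeight w s.vertex = (s.leave : ℕ) - (s.arrive : ℕ) := by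
  have h := hlt s.vertex
  unfold switchSign crossingHeight
  rcases ha with ha | ha <;> rcases hl with hl | hl <;> rw [ha, hl]
  · simp
  · simp [h]
  · simp [h, h.not_gt]
  · simp

lemma sum_leave_sub_arrive (p : List (Passage n N)) (hp : p ≠ [])
    (hc : p.IsChain fun s s' => s'.arrive = s.leave) :
    (p.map fun s => ((s.leave : ℕ) : ℤ) - (s.arrive : ℕ)).sum =
      ((p.getLast hp).leave : ℕ) - ((p.head hp).arrive : ℕ) := by
  induction p with
  | nil => exact absurd rfl hp
  | cons s p ih =>
    cases p with
    | nil => simp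
    | cons s' p =>
      rw [List.isChain_cons_cons] at hc
      have := ih (by simp) hc.2
      rw [List.map_cons, List.sum_cons, this]
      simp [hc.1]

/-- A path from `b_k` to `b_{k+1}` takes the value `1` on the heights: the contributions of its
passages are the changes of the number of the string, so that their sum telescopes. -/
lemma sum_pathCoeff_mul_crossingHeight (hlt : ∀ j, upperLeft w j < upperRight w j) {k : Fin n}
    {p : List (Passage n N)} (hp : IsRigorousPath w k p) :
    ∑ j, (pathCoeff p j : ℝ) * crossingHeight w j = 1 := by
  rw [sum_pathCoeff_mul p fun j => (crossingHeight w j : ℝ)]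
  have h1 : (p.map fun s => (switchSign s : ℝ) * (crossingHeight w s.vertex : ℝ)) =
      (p.map fun s => ((s.leave : ℕ) : ℤ) - (s.arrive : ℕ)).map (Int.cast : ℤ → ℝ) := by
    rw [List.map_map]
    refine List.map_congr_left fun s hs => ?_
    have := switchSign_mul_crossingHeight hlt (hp.on_strings s hs).1 (hp.on_strings s hs).2
    simp only [Function.comp_apply]
    rw [← this]
    push_cast
    rfl
  have h2 := sum_leave_sub_arrive p hp.ne_nil (hp.edges.imp fun s s' h => h.1)
  have h3 := (hp.start (p.head hp.ne_nil) (by simp [List.head?_eq_some_head hp.ne_nil])).1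
  have h4 := (hp.finish (p.getLast hp.ne_nil) (by simp [List.getLast?_eq_some_getLast hp.ne_nil])).1
  rw [h3, h4] at h2
  rw [h1, ← Int.cast_list_sum, h2]
  simp

lemma stringAt_succ_apply (w : Fin N → Fin n) (j : Fin N) (q : Fin (n + 1)) :
    stringAt w j.succ q = if q = (w j).castSucc then upperRight w j
      else if q = (w j).succ then upperLeft w j else stringAt w j.castSucc q := by
  rw [stringAt_succ, Equiv.Perm.mul_apply, simpleReflection, Equiv.swap_apply_def]
  unfold upperLeft upperRight
  split_ifs <;> rfl

lemma sum_Ioi_sub {N : ℕ} (D : Fin (N + 1) → ℤ) (l : Fin N) :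
    ∑ j ∈ Finset.Ioi l, (D j.succ - D j.castSucc) = D (Fin.last N) - D l.succ := by
  have tele : ∀ (M : ℕ) (E : Fin (M + 1) → ℤ),
      ∑ j : Fin M, (E j.succ - E j.castSucc) = E (Fin.last M) - E 0 := by
    intro M
    induction M with
    | zero => intro E; simp
    | succ M ih =>
      intro E
      rw [Fin.sum_univ_castSucc]
      have := ih fun i => E i.castSucc
      simp only [Fin.castSucc_zero] at this
      simp only [Fin.succ_castSucc, Fin.succ_last]
      rw [this]
      ring
  have h := tele N fun m => D (max m l.succ)
  rw [max_eq_left (Fin.le_last _), max_eq_right (Fin.zero_le _)] at h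
  rw [← h, ← Finset.sum_subset (Finset.subset_univ (Finset.Ioi l))]
  · refine Finset.sum_congr rfl fun j hj => ?_
    rw [Finset.mem_Ioi] at hj
    rw [max_eq_left, max_eq_left]
    · exact Fin.le_castSucc_iff.2 (Fin.succ_lt_succ_iff.2 hj)
    · exact Fin.succ_le_succ_iff.2 hj.le
  · intro j _ hj
    rw [Finset.mem_Ioi, not_lt] at hj
    rw [max_eq_right (by simpa using hj), max_eq_right, sub_self]
    simp only [Fin.le_def, Fin.val_castSucc, Fin.val_succ] at *
    omega

/-- The heights satisfy `P_l = 1 + ∑_{j > l} c_{lj} P_j`: below `t_l`, the difference of the strings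
in the positions `i_l` and `i_l + 1` goes from `P_l` to `1`, and `t_j` changes it by
`-c_{lj} P_j`. -/
lemma sum_lambdaCoeff_mul_crossingHeight (hw : wordProd w = longestElement n) (l : Fin N) :
    ∑ j ∈ Finset.Ioi l, lambdaCoeff w l j * crossingHeight w j = crossingHeight w l - 1 := by
  set D : Fin (N + 1) → ℤ := fun m =>
    (stringAt w m (w l).castSucc : ℕ) - (stringAt w m (w l).succ : ℕ) with hD
  have hstep : ∀ j, lambdaCoeff w l j * crossingHeight w j = -(D j.succ - D j.castSucc) := by
    intro j
    have hul : upperLeft w j = stringAt w j.castSucc (w j).castSucc := rfl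
    have hur : upperRight w j = stringAt w j.castSucc (w j).succ := rfl
    simp only [hD, stringAt_succ_apply, lambdaCoeff, crossingHeight]
    by_cases h0 : w j = w l
    · rw [h0] at hul hur
      have h1 : (w l).succ ≠ (w l).castSucc := by simp [Fin.ext_iff]
      simp [h0, h1, ← hul, ← hur]
      ring
    by_cases h1 : (w j : ℕ) = w l + 1
    · have : (w j).castSucc = (w l).succ := by ext; simp [h1]
      rw [this] at hul
      rw [this]
      have h2 : (w l).castSucc ≠ (w l).succ := by simp [Fin.ext_iff]
      have h3 : (w l).castSucc ≠ (w j).succ := by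
        simp only [ne_eq, Fin.ext_iff, Fin.val_castSucc, Fin.val_succ]
        omega
      simp [h1, h2, h3, ← hul]
    by_cases h2 : (w l : ℕ) = w j + 1
    · have : (w j).succ = (w l).castSucc := by ext; simp [h2]
      rw [this] at hur
      rw [this]
      have h3 : (w l).castSucc ≠ (w j).castSucc := by
        simpa [Fin.ext_iff] using fun h => h0 (Fin.ext h.symm)
      have h4 : (w l).succ ≠ (w j).castSucc := by
        simp only [ne_eq, Fin.ext_iff, Fin.val_castSucc, Fin.val_succ]
        omega
      have h5 : (w l).succ ≠ (w l).castSucc := by simp [Fin.ext_iff]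
      simp [h2, h3, h4, h5, ← hur]
    · have h0' : (w j : ℕ) ≠ w l := fun h => h0 (Fin.ext h)
      have e1 : (w l).castSucc ≠ (w j).castSucc := by simpa [Fin.ext_iff] using h0'.symm
      have e2 : (w l).castSucc ≠ (w j).succ := by simpa [Fin.ext_iff] using h2
      have e3 : (w l).succ ≠ (w j).castSucc := by simpa [Fin.ext_iff] using fun h => h1 h.symm
      have e4 : (w l).succ ≠ (w j).succ := by simpa [Fin.ext_iff] using h0'.symm
      simp [h0, h1, h2, e1, e2, e3, e4]
  rw [Finset.sum_congr rfl fun j _ => hstep j, Finset.sum_neg_distrib, sum_Ioi_sub]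
  have hlast : D (Fin.last N) = 1 := by
    simp only [hD, stringAt_last, hw, longestElement, Fin.revPerm_apply, Fin.val_rev,
      Fin.val_castSucc, Fin.val_succ]
    have := (w l).isLt
    omega
  have hl : D l.succ = crossingHeight w l := by
    simp [hD, stringAt_succ_apply, crossingHeight, Fin.ext_iff]
  rw [hlast, hl]
  ring

/-- The outer normals of the string inequalities and of the `λ`-inequalities, with the integral
coefficients of these inequalities. -/
def inequalityNormals (w : Fin N → Fin n) : Set (Fin N → ℤ) :=
  {y | ∃ k p, IsRigorousPath w k p ∧ y = fun j => -pathCoeff p j} ∪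
    Set.range fun l : Fin N => fun j =>
      (if j = l then 1 else 0) - if l < j then lambdaCoeff w l j else 0

lemma abs_pathCoeff_le (p : List (Passage n N)) (j : Fin N) : |pathCoeff p j| ≤ p.length := by
  induction p with
  | nil => simp [pathCoeff]
  | cons s p ih =>
    have h : pathCoeff (s :: p) j = (if s.vertex = j then switchSign s else 0) + pathCoeff p j := by
      simp [pathCoeff]
    have hs : |if s.vertex = j then switchSign s else 0| ≤ 1 := by
      unfold switchSign
      split_ifs <;> simp
    rw [h, List.length_cons]
    push_cast
    linarith [abs_add_le (if s.vertex = j then switchSign s else 0) (pathCoeff p j)]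

/-- There may be many rigorous paths, but they meet at most `N` vertices, so that their coefficients
are bounded. -/
lemma finite_inequalityNormals (w : Fin N → Fin n) : (inequalityNormals w).Finite := by
  refine Set.Finite.union ((Set.finite_Icc (fun _ => -(N : ℤ)) fun _ => (N : ℤ)).subset ?_)
    (Set.finite_range _)
  rintro _ ⟨k, p, hp, rfl⟩
  have hlen : p.length ≤ N := by
    have := hp.nodup.length_le_card
    simpa using this
  have h : ∀ j, |pathCoeff p j| ≤ N := fun j =>
    (abs_pathCoeff_le p j).trans (by exact_mod_cast hlen)
  refine ⟨fun j => ?_, fun j => ?_⟩ <;> have := abs_le.1 (h j) <;> simp only <;> omega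

/-- All inequalities of the string polytope have the value `1` at the point `P` given by the heights
of the crossings. -/
lemma stringPolytope_eq_unitPolyhedron (hw : wordProd w = longestElement n)
    (hlt : ∀ j, upperLeft w j < upperRight w j) :
    stringPolytope w = unitPolyhedron (inequalityNormals w) (crossingHeight w) := by
  have hstring : ∀ k p, IsRigorousPath w k p → ∀ x : Fin N → ℝ,
      ∑ j, ((-pathCoeff p j : ℤ) : ℝ) * (x j - crossingHeight w j)
        = 1 - ∑ j, (pathCoeff p j : ℝ) * x j := by
    intro k p hp x
    rw [← sum_pathCoeff_mul_crossingHeight hlt hp, ← Finset.sum_sub_distrib]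
    exact Finset.sum_congr rfl fun j _ => by push_cast; ring
  have hlambda : ∀ (l : Fin N) (x : Fin N → ℝ),
      ∑ j, (((if j = l then 1 else 0) - if l < j then lambdaCoeff w l j else 0 : ℤ) : ℝ) *
        (x j - crossingHeight w j)
        = x l - ∑ j ∈ Finset.Ioi l, (lambdaCoeff w l j : ℝ) * x j - 1 := by
    intro l x
    have h := sum_lambdaCoeff_mul_crossingHeight hw l
    have h' : ∑ j ∈ Finset.Ioi l, (lambdaCoeff w l j : ℝ) * crossingHeight w j
        = crossingHeight w l - 1 := by exact_mod_cast h
    have hI : Finset.Ioi l = Finset.univ.filter (l < ·) := by ext; simp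
    have h2 : ∀ z : Fin N → ℝ, ∑ j, (if l < j then (lambdaCoeff w l j : ℝ) else 0) * z j
        = ∑ j ∈ Finset.Ioi l, (lambdaCoeff w l j : ℝ) * z j := fun z => by
      rw [hI, Finset.sum_filter]
      exact Finset.sum_congr rfl fun j _ => by split_ifs <;> simp
    push_cast
    simp only [sub_mul, Finset.sum_sub_distrib, h2, mul_sub, h']
    simp
  ext x
  constructor
  · rintro ⟨hs, hl⟩ y (⟨k, p, hp, rfl⟩ | ⟨l, rfl⟩)
    · rw [hstring k p hp]
      linarith [hs k p hp]
    · rw [hlambda]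
      linarith [hl l]
  · intro hx
    refine ⟨fun k p hp => ?_, fun l => ?_⟩
    · have := hx _ (Or.inl ⟨k, p, hp, rfl⟩)
      rw [hstring k p hp] at this
      linarith
    · have := hx _ (Or.inr ⟨l, rfl⟩)
      rw [hlambda] at this
      linarith

/-! ### Strands: descending walks through the string diagram -/

lemma eq_upperLeft_iff {j : Fin N} {a : Fin (n + 1)} :
    a = upperLeft w j ↔ position w j.castSucc a = w j := by
  rw [← position_upperLeft, (position_injective w _).eq_iff]

lemma eq_upperRight_iff {j : Fin N} {a : Fin (n + 1)} :
    a = upperRight w j ↔ position w j.castSucc a = w j + 1 := by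
  rw [← position_upperRight, (position_injective w _).eq_iff]

/-- Induction on the levels below a given vertex. -/
lemma level_induction {j : Fin N} {Q : Fin (N + 1) → Prop} (h0 : Q j.succ)
    (hs : ∀ m, j < m → Q m.castSucc → Q m.succ) (l : Fin (N + 1)) (hl : j.succ ≤ l) : Q l := by
  induction l using Fin.induction with
  | zero => simp at hl
  | succ m ih =>
    rcases (Fin.succ_le_succ_iff.1 hl).eq_or_lt with rfl | hlt
    · exact h0
    · exact hs m hlt (ih (Fin.le_castSucc_iff.2 (Fin.succ_lt_succ_iff.2 hlt)))

/-- A descending walk which begins in the vertex `t_j`: `e l` is the string followed between the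
levels of `t_{l-1}` and `t_l`, and the string may change only in vertices on it. -/
structure IsStrand (w : Fin N → Fin n) (j : Fin N) (e : Fin (N + 1) → Fin (n + 1)) : Prop where
  start : OnString w j (e j.castSucc)
  stay : ∀ m, j ≤ m → ¬OnString w m (e m.castSucc) → e m.succ = e m.castSucc
  turn : ∀ m, j ≤ m → OnString w m (e m.castSucc) → OnString w m (e m.succ)

open Classical in
/-- The vertices below `t_j` on a strand, from top to bottom. -/
noncomputable def visits (w : Fin N → Fin n) (j : Fin N) (e : Fin (N + 1) → Fin (n + 1)) :
    List (Fin N) :=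
  (List.finRange N).filter fun m => j < m ∧ OnString w m (e m.castSucc)

lemma mem_visits {j m : Fin N} {e : Fin (N + 1) → Fin (n + 1)} :
    m ∈ visits w j e ↔ j < m ∧ OnString w m (e m.castSucc) := by
  simp [visits]

lemma pairwise_visits (w : Fin N → Fin n) (j : Fin N) (e : Fin (N + 1) → Fin (n + 1)) :
    (j :: visits w j e).Pairwise (· < ·) := by
  refine List.pairwise_cons.2 ⟨fun m hm => (mem_visits.1 hm).1, ?_⟩
  exact (List.pairwise_lt_finRange N).filter _

namespace IsStrand

variable {j : Fin N} {e : Fin (N + 1) → Fin (n + 1)}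

lemma mem_cons_visits (he : IsStrand w j e) {m : Fin N} :
    m ∈ j :: visits w j e ↔ j ≤ m ∧ OnString w m (e m.castSucc) := by
  rw [List.mem_cons, mem_visits]
  constructor
  · rintro (rfl | h)
    exacts [⟨le_rfl, he.start⟩, ⟨h.1.le, h.2⟩]
  · rintro ⟨h, h'⟩
    rcases h.eq_or_lt with rfl | h
    exacts [Or.inl rfl, Or.inr ⟨h, h'⟩]

lemma eq_of_forall_not_onString (he : IsStrand w j e) {m : Fin N} (hm : j ≤ m)
    (l : Fin (N + 1)) (hl : m.succ ≤ l)
    (h : ∀ q : Fin N, m < q → q.castSucc < l → ¬OnString w q (e q.castSucc)) :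
    e l = e m.succ := by
  refine level_induction (j := m)
    (Q := fun l => (∀ q : Fin N, m < q → q.castSucc < l → ¬OnString w q (e q.castSucc)) →
      e l = e m.succ) (fun _ => rfl) (fun q hq ih h => ?_) l hl h
  rw [he.stay q (hm.trans hq.le) (h q hq Fin.castSucc_lt_succ),
    ih fun q' h1 h2 => h q' h1 (h2.trans Fin.castSucc_lt_succ)]

/-- Successive vertices of a strand are neighbours on the string which joins them. -/
lemma isChain_visits (he : IsStrand w j e) :
    (j :: visits w j e).IsChain fun m m' =>
      e m'.castSucc = e m.succ ∧ IsJustAboveOn w (e m.succ) m m' := by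
  rw [List.isChain_iff_getElem]
  intro i hi
  set V := j :: visits w j e with hV
  have hp : V.Pairwise (· < ·) := pairwise_visits w j e
  have hlt : V[i] < V[i + 1] := List.pairwise_iff_getElem.1 hp i (i + 1) _ hi (by omega)
  have hbetween : ∀ q, q ∈ V → ¬(V[i] < q ∧ q < V[i + 1]) := by
    rintro q hq ⟨h1, h2⟩
    obtain ⟨i', hi', rfl⟩ := List.getElem_of_mem hq
    have h3 : ¬i' ≤ i := fun h => by
      rcases h.eq_or_lt with rfl | h
      · exact lt_irrefl _ h1
      · exact lt_asymm h1 (List.pairwise_iff_getElem.1 hp i' i _ _ h)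
    have h4 : ¬i + 1 ≤ i' := fun h => by
      rcases h.eq_or_lt with rfl | h
      · exact lt_irrefl _ h2
      · exact lt_asymm h2 (List.pairwise_iff_getElem.1 hp (i + 1) i' _ _ h)
    omega
  have hmem := he.mem_cons_visits.1 (List.getElem_mem (show i < V.length by omega))
  have hmem' := he.mem_cons_visits.1 (List.getElem_mem hi)
  have hconst : ∀ q : Fin N, V[i] < q → q ≤ V[i + 1] → e q.castSucc = e V[i].succ := by
    intro q h1 h2
    refine he.eq_of_forall_not_onString hmem.1 q.castSucc (Fin.le_castSucc_iff.2
      (Fin.succ_lt_succ_iff.2 h1)) fun q' h3 h4 h5 => ?_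
    exact hbetween q' (he.mem_cons_visits.2 ⟨hmem.1.trans h3.le, h5⟩)
      ⟨h3, (Fin.castSucc_lt_castSucc_iff.1 h4).trans_le h2⟩
  have heq := hconst V[i + 1] hlt le_rfl
  refine ⟨heq, he.turn _ hmem.1 hmem.2, heq ▸ hmem'.2, hlt, fun q hq hb => ?_⟩
  rw [← hconst q hb.1 hb.2.le] at hq
  exact hbetween q (he.mem_cons_visits.2 ⟨hmem.1.trans hb.1.le, hq⟩) hb

lemma isLowestOn_getLast (he : IsStrand w j e) :
    ∀ m ∈ (j :: visits w j e).getLast?,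
      e m.succ = e (Fin.last N) ∧ IsLowestOn w m (e (Fin.last N)) := by
  intro m hm
  set V := j :: visits w j e with hV
  have hp : V.Pairwise (· < ·) := pairwise_visits w j e
  have hmV : m ∈ V := List.mem_of_getLast? hm
  obtain ⟨V', hV'⟩ := List.getLast?_eq_some_iff.1 hm
  have hle : ∀ q ∈ V, q ≤ m := by
    intro q hq
    rw [hV'] at hq hp
    rcases List.mem_append.1 hq with hq | hq
    · exact ((List.pairwise_append.1 hp).2.2 q hq m (by simp)).le
    · exact (List.mem_singleton.1 hq).le
  have hmem := he.mem_cons_visits.1 hmV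
  have hconst : ∀ l, m.succ ≤ l → e l = e m.succ := fun l hl =>
    he.eq_of_forall_not_onString hmem.1 l hl fun q h1 _ h2 =>
      (hle q (he.mem_cons_visits.2 ⟨hmem.1.trans h1.le, h2⟩)).not_gt h1
  have hlast := hconst _ (Fin.le_last _)
  refine ⟨hlast.symm, hlast ▸ he.turn m hmem.1 hmem.2, fun q hq => ?_⟩
  by_contra hlt
  rw [not_le] at hlt
  rw [hlast, ← hconst q.castSucc (Fin.le_castSucc_iff.2 (Fin.succ_lt_succ_iff.2 hlt))] at hq
  exact hlt.not_ge (hle q (he.mem_cons_visits.2 ⟨hmem.1.trans hlt.le, hq⟩))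

end IsStrand

/-- The walk which arrives in `t_j` along `U_a`, leaves it along `U_b`, and then changes strings
according to the rule `step`. -/
def strandFrom (j : Fin N) (a b : Fin (n + 1)) (step : Fin N → Fin (n + 1) → Fin (n + 1))
    (l : Fin (N + 1)) : Fin (n + 1) :=
  Fin.induction (motive := fun _ => Fin (n + 1)) a
    (fun m x => if m < j then a else if m = j then b else step m x) l

section strandFrom

variable (j : Fin N) (a b : Fin (n + 1)) (step : Fin N → Fin (n + 1) → Fin (n + 1))

lemma strandFrom_succ (m : Fin N) : strandFrom j a b step m.succ =
    if m < j then a else if m = j then b else step m (strandFrom j a b step m.castSucc) :=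
  Fin.induction_succ _ _ _

lemma strandFrom_castSucc_self : strandFrom j a b step j.castSucc = a := by
  rcases Fin.eq_zero_or_eq_succ j.castSucc with h | ⟨m, h⟩
  · rw [h]
    rfl
  · rw [h, strandFrom_succ, if_pos]
    have := congrArg Fin.val h
    simp only [Fin.val_castSucc, Fin.val_succ] at this
    rw [Fin.lt_def]
    omega

lemma strandFrom_succ_self : strandFrom j a b step j.succ = b := by
  simp [strandFrom_succ]

lemma strandFrom_succ_of_lt {m : Fin N} (hm : j < m) :
    strandFrom j a b step m.succ = step m (strandFrom j a b step m.castSucc) := by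
  simp [strandFrom_succ, hm.not_gt, hm.ne']

lemma isStrand_strandFrom (w : Fin N → Fin n) (ha : OnString w j a) (hb : OnString w j b)
    (hstay : ∀ m x, ¬OnString w m x → step m x = x)
    (hturn : ∀ m x, OnString w m x → OnString w m (step m x)) :
    IsStrand w j (strandFrom j a b step) where
  start := by rwa [strandFrom_castSucc_self]
  stay m hm h := by
    rcases hm.eq_or_lt with rfl | hm
    · rw [strandFrom_castSucc_self] at h
      exact absurd ha h
    · rw [strandFrom_succ_of_lt _ _ _ _ hm, hstay _ _ h]
  turn m hm h := by
    rcases hm.eq_or_lt with rfl | hm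
    · rwa [strandFrom_succ_self]
    · rw [strandFrom_succ_of_lt _ _ _ _ hm]
      exact hturn _ _ h

end strandFrom

/-! ### The greedy rigorous path through a crossing -/

/-- The rule of the forward part of the greedy path: following a string downward, switch in a vertex
to the crossing string if its number is smaller, but still above `k`. -/
def downStep (w : Fin N → Fin n) (k : Fin n) (m : Fin N) (x : Fin (n + 1)) : Fin (n + 1) :=
  if x = upperRight w m ∧ k.castSucc < upperLeft w m then upperLeft w m else x

/-- The rule of the backward part of the greedy path: following a string downward, switch in a vertex
to the crossing string if its number is larger, but at most `k`. -/
def upStep (w : Fin N → Fin n) (k : Fin n) (m : Fin N) (x : Fin (n + 1)) : Fin (n + 1) :=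
  if x = upperLeft w m ∧ upperRight w m ≤ k.castSucc then upperRight w m else x

/-- The part of the greedy path from `t_j` on, which leaves `t_j` on the string with the larger
number. -/
def downStrand (w : Fin N → Fin n) (k : Fin n) (j : Fin N) : Fin (N + 1) → Fin (n + 1) :=
  strandFrom j (upperLeft w j) (upperRight w j) (downStep w k)

/-- The part of the greedy path up to `t_j`, followed backward and thus downward; the path reaches
`t_j` on the string with the smaller number. -/
def upStrand (w : Fin N → Fin n) (k : Fin n) (j : Fin N) : Fin (N + 1) → Fin (n + 1) :=
  strandFrom j (upperRight w j) (upperLeft w j) (upStep w k)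

lemma downStrand_succ {k : Fin n} {j m : Fin N} (hm : j < m) :
    downStrand w k j m.succ = downStep w k m (downStrand w k j m.castSucc) :=
  strandFrom_succ_of_lt _ _ _ _ hm

lemma upStrand_succ {k : Fin n} {j m : Fin N} (hm : j < m) :
    upStrand w k j m.succ = upStep w k m (upStrand w k j m.castSucc) :=
  strandFrom_succ_of_lt _ _ _ _ hm

lemma isStrand_downStrand (w : Fin N → Fin n) (k : Fin n) (j : Fin N) :
    IsStrand w j (downStrand w k j) := by
  refine isStrand_strandFrom _ _ _ _ w (Or.inl rfl) (Or.inr rfl) (fun m x h => ?_) fun m x h => ?_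
  · exact if_neg fun h' => h (Or.inr h'.1)
  · unfold downStep
    split_ifs
    exacts [Or.inl rfl, h]

lemma isStrand_upStrand (w : Fin N → Fin n) (k : Fin n) (j : Fin N) :
    IsStrand w j (upStrand w k j) := by
  refine isStrand_strandFrom _ _ _ _ w (Or.inr rfl) (Or.inl rfl) (fun m x h => ?_) fun m x h => ?_
  · exact if_neg fun h' => h (Or.inl h'.1)
  · unfold upStep
    split_ifs
    exacts [Or.inr rfl, h]

lemma position_downStep (w : Fin N → Fin n) (k : Fin n) (m : Fin N) (x : Fin (n + 1)) :
    position w m.succ (downStep w k m x) =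
      if x = upperRight w m then if k.castSucc < upperLeft w m then (w m : ℕ) + 1 else w m
      else if x = upperLeft w m then (w m : ℕ) + 1 else position w m.castSucc x := by
  have hne := upperLeft_ne_upperRight w m
  unfold downStep
  rw [position_succ]
  split_ifs <;> simp_all

lemma position_upStep (w : Fin N → Fin n) (k : Fin n) (m : Fin N) (x : Fin (n + 1)) :
    position w m.succ (upStep w k m x) =
      if x = upperLeft w m then if upperRight w m ≤ k.castSucc then (w m : ℕ) else w m + 1
      else if x = upperRight w m then (w m : ℕ) else position w m.castSucc x := by
  have hne := upperLeft_ne_upperRight w m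
  unfold upStep
  rw [position_succ]
  split_ifs <;> simp_all

/-- If just below `t_j` the string `U_k` is not to the left of the backward part and `U_{k+1}` not to
the right of the forward part, this remains so at all lower levels, and the forward part stays to the
left of the backward part. -/
lemma strand_invariant (hlt : ∀ j, upperLeft w j < upperRight w j) {k : Fin n} {j : Fin N}
    (hak : upperLeft w j ≤ k.castSucc) (hkb : k.castSucc < upperRight w j)
    (hk : (w j : ℕ) < position w j.succ k.castSucc) (hk' : position w j.succ k.succ ≤ w j)
    (l : Fin (N + 1)) (hl : j.succ ≤ l) :
    upStrand w k j l ≤ k.castSucc ∧ k.castSucc < downStrand w k j l ∧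
      position w l (downStrand w k j l) < position w l (upStrand w k j l) ∧
      position w l k.succ ≤ position w l (downStrand w k j l) ∧
      position w l (upStrand w k j l) ≤ position w l k.castSucc := by
  revert l
  refine level_induction ?_ fun m hm ih => ?_
  · rw [upStrand, downStrand, strandFrom_succ_self, strandFrom_succ_self]
    have hne := (upperLeft_ne_upperRight w j).symm
    have h1 : position w j.succ (upperLeft w j) = w j + 1 := by simp [position_succ]
    have h2 : position w j.succ (upperRight w j) = w j := by simp [position_succ, hne]
    rw [h1, h2]
    exact ⟨hak, hkb, by omega, hk', hk⟩
  · rw [upStrand_succ hm, downStrand_succ hm]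
    generalize upStrand w k j m.castSucc = x at ih
    generalize downStrand w k j m.castSucc = y at ih
    obtain ⟨hx, hy, hyx, hky, hxk⟩ := ih
    have huv := hlt m
    have hxl := @eq_upperLeft_iff _ _ w m x
    have hyl := @eq_upperLeft_iff _ _ w m y
    have hxr := @eq_upperRight_iff _ _ w m x
    have hyr := @eq_upperRight_iff _ _ w m y
    have hkl := @eq_upperLeft_iff _ _ w m k.castSucc
    have hkr := @eq_upperRight_iff _ _ w m k.castSucc
    have hsl := @eq_upperLeft_iff _ _ w m k.succ
    have hsr := @eq_upperRight_iff _ _ w m k.succ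
    -- what remains is a comparison of the numbers and positions in the vertex `t_m`
    rw [position_downStep, position_upStep, position_succ, position_succ]
    simp only [Fin.ext_iff, Fin.lt_def, Fin.le_def, Fin.val_castSucc, Fin.val_succ] at *
    refine ⟨?_, ?_, ?_, ?_, ?_⟩
    · unfold upStep
      split_ifs with h
      exacts [h.2, hx]
    · unfold downStep
      split_ifs with h
      exacts [h.2, hy]
    all_goals split_ifs <;> omega

/-- At the bottom the strings are in reversed order. Hence the forward part ends in `b_{k+1}`, and
the backward part in `b_k`. -/
lemma strand_last (hw : wordProd w = longestElement n)
    (hlt : ∀ j, upperLeft w j < upperRight w j) {k : Fin n} {j : Fin N}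
    (hak : upperLeft w j ≤ k.castSucc) (hkb : k.castSucc < upperRight w j)
    (hk : (w j : ℕ) < position w j.succ k.castSucc) (hk' : position w j.succ k.succ ≤ w j) :
    upStrand w k j (Fin.last N) = k.castSucc ∧ downStrand w k j (Fin.last N) = k.succ := by
  obtain ⟨h1, h2, -, h4, h5⟩ := strand_invariant hlt hak hkb hk hk' _ (Fin.le_last _)
  simp only [position_last hw, Fin.ext_iff, Fin.lt_def, Fin.le_def, Fin.val_castSucc,
    Fin.val_succ] at *
  have := (upStrand w k j (Fin.last N)).isLt
  have := (downStrand w k j (Fin.last N)).isLt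
  omega

/-- The list of the passages of the greedy path through `t_j`: the backward part reversed, the
switch in `t_j`, and the forward part. -/
noncomputable def greedyPath (w : Fin N → Fin n) (k : Fin n) (j : Fin N) : List (Passage n N) :=
  (visits w j (upStrand w k j)).reverse.map
      (fun m => ⟨m, upStrand w k j m.succ, upStrand w k j m.castSucc⟩) ++
    ⟨j, upperLeft w j, upperRight w j⟩ ::
      (visits w j (downStrand w k j)).map
        fun m => ⟨m, downStrand w k j m.castSucc, downStrand w k j m.succ⟩

lemma forall_mem_greedyPath {k : Fin n} {j : Fin N} {Q : Passage n N → Prop}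
    (hup : ∀ m, j < m → OnString w m (upStrand w k j m.castSucc) →
      Q ⟨m, upStep w k m (upStrand w k j m.castSucc), upStrand w k j m.castSucc⟩)
    (hj : Q ⟨j, upperLeft w j, upperRight w j⟩)
    (hdown : ∀ m, j < m → OnString w m (downStrand w k j m.castSucc) →
      Q ⟨m, downStrand w k j m.castSucc, downStep w k m (downStrand w k j m.castSucc)⟩) :
    ∀ s ∈ greedyPath w k j, Q s := by
  intro s hs
  simp only [greedyPath, List.mem_append, List.mem_map, List.mem_reverse, mem_visits,
    List.mem_cons] at hs
  rcases hs with ⟨m, ⟨h1, h2⟩, rfl⟩ | rfl | ⟨m, ⟨h1, h2⟩, rfl⟩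
  · have := hup m h1 h2
    rwa [← upStrand_succ h1] at this
  · exact hj
  · have := hdown m h1 h2
    rwa [← downStrand_succ h1] at this

lemma isRigorousPath_greedyPath (hw : wordProd w = longestElement n)
    (hlt : ∀ j, upperLeft w j < upperRight w j) {k : Fin n} {j : Fin N}
    (hak : upperLeft w j ≤ k.castSucc) (hkb : k.castSucc < upperRight w j)
    (hk : (w j : ℕ) < position w j.succ k.castSucc) (hk' : position w j.succ k.succ ≤ w j) :
    IsRigorousPath w k (greedyPath w k j) := by
  have hinv := fun m (hm : j < m) => strand_invariant hlt hak hkb hk hk' m.castSucc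
    (Fin.le_castSucc_iff.2 (Fin.succ_lt_succ_iff.2 hm))
  have hinv' := fun m (hm : j ≤ m) => strand_invariant hlt hak hkb hk hk' m.succ
    (Fin.succ_le_succ_iff.2 hm)
  obtain ⟨hlast1, hlast2⟩ := strand_last hw hlt hak hkb hk hk'
  have hu := isStrand_upStrand w k j
  have hd := isStrand_downStrand w k j
  have hju : upStrand w k j j.castSucc = upperRight w j := strandFrom_castSucc_self _ _ _ _
  have hju' : upStrand w k j j.succ = upperLeft w j := strandFrom_succ_self _ _ _ _
  have hjd : downStrand w k j j.castSucc = upperLeft w j := strandFrom_castSucc_self _ _ _ _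
  have hjd' : downStrand w k j j.succ = upperRight w j := strandFrom_succ_self _ _ _ _
  set fu : Fin N → Passage n N := fun m => ⟨m, upStrand w k j m.succ, upStrand w k j m.castSucc⟩
    with hfu
  set fd : Fin N → Passage n N :=
    fun m => ⟨m, downStrand w k j m.castSucc, downStrand w k j m.succ⟩ with hfd
  -- the passage through `t_j` belongs to both strands
  have hfuj : fu j = ⟨j, upperLeft w j, upperRight w j⟩ := by simp [hfu, hju, hju']
  have hfdj : fd j = ⟨j, upperLeft w j, upperRight w j⟩ := by simp [hfd, hjd, hjd']
  have hpath : greedyPath w k j = (visits w j (upStrand w k j)).reverse.map fu ++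
    ⟨j, upperLeft w j, upperRight w j⟩ :: (visits w j (downStrand w k j)).map fd := rfl
  have hpathu : greedyPath w k j = (j :: visits w j (upStrand w k j)).reverse.map fu ++
      (visits w j (downStrand w k j)).map fd := by
    simp [hpath, hfuj]
  have hpathd : greedyPath w k j = (visits w j (upStrand w k j)).reverse.map fu ++
      (j :: visits w j (downStrand w k j)).map fd := by
    simp [hpath, hfdj]
  refine ⟨by simp [hpath], ?_, ?_, ?_, ?_, ?_, ?_⟩
  · refine forall_mem_greedyPath (fun m hm h => ⟨?_, h⟩) ⟨Or.inl rfl, Or.inr rfl⟩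
      fun m hm h => ⟨h, ?_⟩
    · have := hu.turn m hm.le h
      rwa [upStrand_succ hm] at this
    · have := hd.turn m hm.le h
      rwa [downStrand_succ hm] at this
  · intro s hs
    rw [hpathu, List.head?_append_of_ne_nil _ (by simp), List.head?_map, List.head?_reverse,
      Option.mem_def, Option.map_eq_some_iff] at hs
    obtain ⟨m, hm, rfl⟩ := hs
    have := hu.isLowestOn_getLast m hm
    rwa [hlast1] at this
  · intro s hs
    rw [hpathd, List.getLast?_append_of_ne_nil _ (by simp), List.getLast?_map,
      Option.mem_def, Option.map_eq_some_iff] at hs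
    obtain ⟨m, hm, rfl⟩ := hs
    have := hd.isLowestOn_getLast m hm
    rwa [hlast2] at this
  · rw [hpath, List.isChain_split]
    constructor
    · have h1 : (visits w j (upStrand w k j)).reverse.map fu ++
          [⟨j, upperLeft w j, upperRight w j⟩] =
          ((j :: visits w j (upStrand w k j)).map fu).reverse := by simp [hfuj]
      rw [h1, List.isChain_reverse, List.isChain_map]
      have hge : ∀ m ∈ j :: visits w j (upStrand w k j), j ≤ m := fun m hm =>
        (hu.mem_cons_visits.1 hm).1
      refine hu.isChain_visits.imp_of_mem_imp fun m m' hm _ h => ⟨h.1.symm, Or.inl ?_⟩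
      simp only [hfu]
      rw [h.1]
      exact ⟨(hinv' m (hge m hm)).1, h.2⟩
    · rw [← hfdj, ← List.map_cons, List.isChain_map]
      have hge : ∀ m ∈ j :: visits w j (downStrand w k j), j ≤ m := fun m hm =>
        (hd.mem_cons_visits.1 hm).1
      refine hd.isChain_visits.imp_of_mem_imp fun m m' hm _ h => ⟨h.1, Or.inr ?_⟩
      exact ⟨(hinv' m (hge m hm)).2.1.not_ge, h.2⟩
  · have hmap : (greedyPath w k j).map Passage.vertex =
        (visits w j (upStrand w k j)).reverse ++ j :: visits w j (downStrand w k j) := by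
      simp [hpath, hfu, hfd, Function.comp_def]
    rw [hmap, List.nodup_append']
    have hpu := pairwise_visits w j (upStrand w k j)
    have hpd := pairwise_visits w j (downStrand w k j)
    refine ⟨List.nodup_reverse.2 (List.pairwise_cons.1 hpu).2.nodup, hpd.nodup, ?_⟩
    intro m hm hm'
    rw [List.mem_reverse, mem_visits] at hm
    obtain ⟨hjm, hon⟩ := hm
    have hon' := (hd.mem_cons_visits.1 hm').2
    obtain ⟨h1, h2, h3, -, -⟩ := hinv m hjm
    -- the forward part is to the left of the backward part, so it could only be `upperLeft`
    have hl := position_upperLeft w m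
    have hr := position_upperRight w m
    have hlr := hlt m
    rcases hon with hon | hon <;> rcases hon' with hon' | hon' <;> rw [hon, hon'] at h3 <;>
      rw [hon] at h1 <;> rw [hon'] at h2
    · exact lt_irrefl _ h3
    · omega
    · exact absurd (h1.trans_lt h2) hlr.not_gt
    · exact lt_irrefl _ h3
  · refine forall_mem_greedyPath (fun m hm h => ?_) ?_ fun m hm h => ?_
    · rintro (⟨-, h2, h3, h4⟩ | ⟨-, h2, h3, h4⟩) <;> dsimp only at h2 h3 h4
      · rw [upStep, if_pos ⟨h4, h2⟩] at h3
        exact upperLeft_ne_upperRight w m h3.symm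
      · have := (hinv m hm).1
        rw [h4] at this
        exact h2 this
    · rintro (⟨-, -, -, h⟩ | ⟨-, -, h, -⟩)
      exacts [upperLeft_ne_upperRight w j h.symm, upperLeft_ne_upperRight w j h]
    · rintro (⟨h1, -, h3, -⟩ | ⟨h1, -, h3, h4⟩) <;> dsimp only at h1 h3
      · have := (hinv m hm).2.1
        rw [h3] at this
        exact h1.not_gt this
      · dsimp only at h4
        rw [downStep, if_pos ⟨h3, not_le.1 h1⟩] at h4
        exact upperLeft_ne_upperRight w m h4

lemma switchSign_nonpos {s : Passage n N} (h : s.leave ≤ s.arrive) : switchSign s ≤ 0 := by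
  rw [switchSign, if_neg h.not_gt]
  split_ifs <;> simp

/-- The coefficients of the inequality of the greedy path through `t_j` are nonpositive, except for the
coefficient `1` at `t_j`, and its other vertices are below `t_j`. -/
lemma nonneg_of_nonneg_below (hw : wordProd w = longestElement n)
    (hlt : ∀ j, upperLeft w j < upperRight w j) {x : Fin N → ℝ} (hx : x ∈ stringCone w)
    (j : Fin N) (hj : ∀ m, j < m → 0 ≤ x m) : 0 ≤ x j := by
  -- `k` is chosen between the two strings such that `U_k` is on the right and `U_{k+1}` on the left
  obtain ⟨k, hak, hkb, hk, hk'⟩ : ∃ k : Fin n, upperLeft w j ≤ k.castSucc ∧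
      k.castSucc < upperRight w j ∧ (w j : ℕ) < position w j.succ k.castSucc ∧
      position w j.succ k.succ ≤ w j := by
    by_contra! hcon
    have hstep : ∀ q : Fin (n + 1), upperLeft w j ≤ q → q ≤ upperRight w j →
        (w j : ℕ) < position w j.succ q := by
      intro q
      induction q using Fin.induction with
      | zero =>
        intro h _
        rw [← Fin.le_zero_iff.1 h]
        simp [position_succ]
      | succ k ih =>
        intro h h'
        rcases h.eq_or_lt with heq | hlt'
        · rw [← heq]
          simp [position_succ]
        · have h1 := Fin.le_castSucc_iff.2 hlt'
          have h2 := Fin.castSucc_lt_iff_succ_le.2 h'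
          exact hcon k h1 h2 (ih h1 h2.le)
    have := hstep _ (hlt j).le le_rfl
    simp [position_succ, (upperLeft_ne_upperRight w j).symm] at this
  have hpos := hx k _ (isRigorousPath_greedyPath hw hlt hak hkb hk hk')
  rw [sum_pathCoeff_mul, greedyPath, List.map_append, List.sum_append, List.map_cons,
    List.sum_cons] at hpos
  have hsign : switchSign (⟨j, upperLeft w j, upperRight w j⟩ : Passage n N) = 1 := by
    simp [switchSign, hlt j]
  rw [hsign] at hpos
  have hterm : ∀ s : Passage n N, j < s.vertex → s.leave ≤ s.arrive →
      (switchSign s : ℝ) * x s.vertex ≤ 0 := fun s h1 h2 =>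
    mul_nonpos_of_nonpos_of_nonneg (by exact_mod_cast switchSign_nonpos h2) (hj _ h1)
  have hsum : ∀ l : List ℝ, (∀ r ∈ l, r ≤ 0) → l.sum ≤ 0 := fun l h => by
    simpa using List.sum_le_card_nsmul l 0 h
  have hup := hsum (((visits w j (upStrand w k j)).reverse.map
      fun m => (⟨m, upStrand w k j m.succ, upStrand w k j m.castSucc⟩ : Passage n N)).map
      fun s => (switchSign s : ℝ) * x s.vertex) (by
    simp only [List.mem_map, List.mem_reverse, mem_visits]
    rintro _ ⟨_, ⟨m, ⟨hm, -⟩, rfl⟩, rfl⟩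
    refine hterm _ hm ?_
    dsimp only
    rw [upStrand_succ hm]
    unfold upStep
    split_ifs with h
    exacts [h.1 ▸ (hlt m).le, le_rfl])
  have hdown := hsum (((visits w j (downStrand w k j)).map
      fun m => (⟨m, downStrand w k j m.castSucc, downStrand w k j m.succ⟩ : Passage n N)).map
      fun s => (switchSign s : ℝ) * x s.vertex) (by
    simp only [List.mem_map, mem_visits]
    rintro _ ⟨_, ⟨m, ⟨hm, -⟩, rfl⟩, rfl⟩
    refine hterm _ hm ?_
    dsimp only
    rw [downStrand_succ hm]
    unfold downStep
    split_ifs with h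
    exacts [h.1 ▸ (hlt m).le, le_rfl])
  simp only [Int.cast_one, one_mul] at hpos
  linarith

lemma nonneg_of_mem_stringCone (hw : wordProd w = longestElement n)
    (hlt : ∀ j, upperLeft w j < upperRight w j) {x : Fin N → ℝ} (hx : x ∈ stringCone w)
    (j : Fin N) : 0 ≤ x j := by
  induction j using WellFoundedGT.induction with
  | ind j ih => exact nonneg_of_nonneg_below hw hlt hx j ih

/-! ### Boundedness -/

lemma isBounded_stringPolytope (hw : wordProd w = longestElement n)
    (hlt : ∀ j, upperLeft w j < upperRight w j) : Bornology.IsBounded (stringPolytope w) := by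
  have hbound : ∀ l : Fin N, ∃ C : ℝ, ∀ x ∈ stringPolytope w, x l ≤ C := by
    intro l
    induction l using WellFoundedGT.induction with
    | ind l ih =>
      choose! C hC using ih
      refine ⟨2 + ∑ j ∈ Finset.Ioi l, C j, fun x hx => (hx.2 l).trans ?_⟩
      gcongr with j hj
      have h0 := nonneg_of_mem_stringCone hw hlt hx.1 j
      have hc : (lambdaCoeff w l j : ℝ) ≤ 1 := by
        unfold lambdaCoeff
        split_ifs <;> norm_num
      nlinarith [hC j (Finset.mem_Ioi.1 hj) x hx]
  choose C hC using hbound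
  exact (isCompact_Icc (a := (0 : Fin N → ℝ)) (b := C)).isBounded.subset fun x hx =>
    ⟨fun j => nonneg_of_mem_stringCone hw hlt hx.1 j, fun j => hC j x hx⟩

end StringPolytope

/-- For every reduced decomposition `w` of the longest element of `S_{n+1}`, the polyhedron `Δ(w)` is
bounded, it has exactly one lattice point `P` in its interior, and its dual polytope (with respect to
`P`) is integral. -/
theorem theorem3p4 (n N : ℕ) (w : Fin N → Fin n)
    (hw : StringPolytope.IsReducedDecomposition w (StringPolytope.longestElement n)) :
    Bornology.IsBounded (StringPolytope.stringPolytope w) ∧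
    ∃ P : Fin N → ℤ,
      (∀ Q : Fin N → ℤ,
        StringPolytope.latticePoint Q ∈ interior (StringPolytope.stringPolytope w) ↔ Q = P) ∧
      StringPolytope.IsIntegralPolytope
        (StringPolytope.dualPolytope (StringPolytope.stringPolytope w)
          (StringPolytope.latticePoint P)) := by
  have hlt := hw.upperLeft_lt_upperRight
  have hb := StringPolytope.isBounded_stringPolytope hw.1 hlt
  refine ⟨hb, StringPolytope.crossingHeight w, ?_⟩
  have hfin := StringPolytope.finite_inequalityNormals w
  rw [StringPolytope.stringPolytope_eq_unitPolyhedron hw.1 hlt] at hb ⊢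
  exact ⟨StringPolytope.latticePoint_mem_interior_iff hfin hb,
    StringPolytope.isIntegralPolytope_dualPolytope hfin _⟩
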